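/- Let $\mathcal H,\mathcal K$ be finite dimensional complex Hilbert spaces and let $\mathcal A\subseteq B(\mathcal H)$, $\mathcal B\subseteq B(\mathcal K)$ be $C^*$-algebras containing the identity operators. A density operator in $\mathcal A$ is a positive $\sigma\in\mathcal A$ with $\mathrm{Tr}\,\sigma=1$; $\mathrm{supp}\,\sigma$ denotes its support projection. For a linear map $T:\mathcal A\to\mathcal B$ let $T^*:\mathcal B\to\mathcal A$ be its adjoint with respect to the Hilbert-Schmidt inner products $\langle a,b\rangle=\mathrm{Tr}\,a^*b$. A linear map $\Phi$ between such algebras is a unital Schwarz map if $\Phi(I)=I$ and $\Phi(a^*a)\ge\Phi(a)^*\Phi(a)$ for all $a$. For a density operator $\sigma\in\mathcal A$, with $q=\mathrm{supp}\,\sigma$ and $q_0=\mathrm{supp}\,T(\sigma)$, let $T_\sigma:q\mathcal A q\to q_0\mathcal B q_0$ be the map $$T_\sigma(b)=T(\sigma)^{-1/2}\,T(\sigma^{1/2}b\,\sigma^{1/2})\,T(\sigma)^{-1/2},\qquad b\in q\mathcal A q,$$ where $T(\sigma)^{-1/2}$ is the inverse of $T(\sigma)^{1/2}$ on the support of $T(\sigma)$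 and $0$ on its orthogonal complement. Let $\mathcal S$ be a set of density operators in $\mathcal A$ and let $T:\mathcal A\to\mathcal B$ be a linear map such that $T^*$ is a unital Schwarz map. Call $T$ reversible for $\mathcal S$ if there is a linear map $S:\mathcal B\to\mathcal A$ such that $S^*$ is a unital Schwarz map and $S(T(\sigma))=\sigma$ for all $\sigma\in\mathcal S$. Suppose that $\rho\in\mathcal S$ is such that $\rho$ and $T(\rho)$ are invertible, and that $T_\rho:\mathcal A\to\mathcal B$ is a unital Schwarz map. Then $T$ is reversible for $\mathcal S$ if and only if, for every $\sigma\in\mathcal S$, $$T_\sigma=T_\rho|_{\mathrm{supp}\,\sigma\,\mathcal A\,\mathrm{supp}\,\sigma}.$$ -/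

import Mathlib

/-!
Put `r = ρ^{1/2}` and `r' = T(ρ)^{1/2}`. The maps `α = T*` and `β = T_ρ` are adjoint for the KMS
inner products `⟨a, b⟩ = Tr r a* r b` and `⟨a, b⟩ = Tr r' a* r' b`, and positive unital maps that
are adjoint in this way contract the KMS norms, because no eigenvalue of their composition exceeds
`1`. If `S` reverses `T`, then `β` preserves the KMS norm of `d = r⁻¹ σ r⁻¹`, and the equality case
of the contraction is `α (β d) = d`. The fixed points of `α ∘ β` form a *-algebra on which `β` is
multiplicative and intertwines the modular maps `x ↦ r⁻¹ x r` and `x ↦ r'⁻¹ x r'`. Hence `β` also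
intertwines `x ↦ ρ⁻¹ x σ` with `x ↦ T(ρ)⁻¹ x T(σ)` there; taking square roots of these positive
operators and evaluating at `x = 1` shows that the cocycle `ρ^{-1/2} σ^{1/2}` is a fixed point with
image `T(ρ)^{-1/2} T(σ)^{1/2}`, and multiplicativity turns `T_σ` into `T_ρ`.

Conversely, evaluating `T_σ = T_ρ` at `q = supp σ` gives `T_ρ(q) = supp T(σ)`, a projection, so `q`
lies in the multiplicative domain of `T_ρ`. Hence
`Tr a T_ρ*(T(σ)) = Tr T_ρ(q a q) T(σ) = Tr T_σ(q a q) T(σ) = Tr a σ`, and `T_ρ*` reverses `T`.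
-/

namespace PetzRecovery

/-- The trace `Tr = Tr_H` on `B(H)`. -/
noncomputable def opTrace {H : Type*} [NormedAddCommGroup H] [InnerProductSpace ℂ H]
    (a : H →L[ℂ] H) : ℂ :=
  LinearMap.trace ℂ H (a : H →ₗ[ℂ] H)

theorem opTrace_star {H : Type*} [NormedAddCommGroup H] [InnerProductSpace ℂ H]
    [FiniteDimensional ℂ H] [CompleteSpace H] (a : H →L[ℂ] H) :
    opTrace (star a) = star (opTrace a) := by
  have b := stdOrthonormalBasis ℂ H
  simp only [opTrace, LinearMap.trace_eq_sum_inner _ b, star_sum]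
  refine Finset.sum_congr rfl fun i _ => ?_
  simp [ContinuousLinearMap.star_eq_adjoint, ContinuousLinearMap.adjoint_inner_right]

theorem opTrace_star_mul_self {H : Type*} [NormedAddCommGroup H] [InnerProductSpace ℂ H]
    [FiniteDimensional ℂ H] [CompleteSpace H] {ι : Type*} [Fintype ι]
    (b : OrthonormalBasis ι ℂ H) (a : H →L[ℂ] H) :
    opTrace (star a * a) = ((∑ i, ‖a (b i)‖ ^ 2 : ℝ) : ℂ) := by
  simp only [opTrace, LinearMap.trace_eq_sum_inner _ b, Complex.ofReal_sum]
  refine Finset.sum_congr rfl fun i _ => ?_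
  simp [ContinuousLinearMap.star_eq_adjoint, ContinuousLinearMap.adjoint_inner_right,
    inner_self_eq_norm_sq_to_K]

/-- The Hilbert-Schmidt inner product `⟨a, b⟩ = Tr a* b` on a *-subalgebra `𝒜 ⊆ B(H)`. -/
noncomputable abbrev hsCore {H : Type*} [NormedAddCommGroup H] [InnerProductSpace ℂ H]
    [FiniteDimensional ℂ H] [CompleteSpace H] (𝒜 : StarSubalgebra ℂ (H →L[ℂ] H)) :
    InnerProductSpace.Core ℂ 𝒜 where
  inner a b := opTrace (star (a : H →L[ℂ] H) * (b : H →L[ℂ] H))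
  conj_inner_symm a b := by
    rw [starRingEnd_apply, ← opTrace_star]
    simp
  re_inner_nonneg a := by
    rw [opTrace_star_mul_self (stdOrthonormalBasis ℂ H)]
    simp only [RCLike.re_eq_complex_re, Complex.ofReal_re]
    positivity
  add_left a b c := by simp [opTrace, add_mul]
  smul_left a b r := by simp [opTrace]
  definite a h := by
    have b := stdOrthonormalBasis ℂ H
    rw [opTrace_star_mul_self b, Complex.ofReal_eq_zero,
      Finset.sum_eq_zero_iff_of_nonneg (fun i _ => by positivity)] at h
    apply Subtype.ext
    apply ContinuousLinearMap.coe_injective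
    refine b.toBasis.ext fun i => ?_
    simpa using h i (Finset.mem_univ i)

/-- The adjoint of a linear map between finite dimensional spaces with given inner products. -/
noncomputable def coreAdjoint {V W : Type*} [AddCommGroup V] [Module ℂ V] [FiniteDimensional ℂ V]
    [AddCommGroup W] [Module ℂ W] [FiniteDimensional ℂ W]
    (cV : InnerProductSpace.Core ℂ V) (cW : InnerProductSpace.Core ℂ W)
    (T : V →ₗ[ℂ] W) : W →ₗ[ℂ] V :=
  letI : NormedAddCommGroup V := cV.toNormedAddCommGroup
  letI : InnerProductSpace ℂ V := InnerProductSpace.ofCore cV.toCore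
  letI : NormedAddCommGroup W := cW.toNormedAddCommGroup
  letI : InnerProductSpace ℂ W := InnerProductSpace.ofCore cW.toCore
  LinearMap.adjoint T

theorem coreAdjoint_spec {V W : Type*} [AddCommGroup V] [Module ℂ V] [FiniteDimensional ℂ V]
    [AddCommGroup W] [Module ℂ W] [FiniteDimensional ℂ W]
    (cV : InnerProductSpace.Core ℂ V) (cW : InnerProductSpace.Core ℂ W)
    (T : V →ₗ[ℂ] W) (w : W) (v : V) :
    cV.inner (coreAdjoint cV cW T w) v = cW.inner w (T v) :=
  letI : NormedAddCommGroup V := cV.toNormedAddCommGroup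
  letI : InnerProductSpace ℂ V := InnerProductSpace.ofCore cV.toCore
  letI : NormedAddCommGroup W := cW.toNormedAddCommGroup
  letI : InnerProductSpace ℂ W := InnerProductSpace.ofCore cW.toCore
  LinearMap.adjoint_inner_left T v w

instance instFiniteDimensionalCoe {H : Type*} [NormedAddCommGroup H] [InnerProductSpace ℂ H]
    [FiniteDimensional ℂ H] [CompleteSpace H] (𝒜 : StarSubalgebra ℂ (H →L[ℂ] H)) :
    FiniteDimensional ℂ 𝒜 :=
  inferInstanceAs (FiniteDimensional ℂ (Subalgebra.toSubmodule 𝒜.toSubalgebra))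

/-- The adjoint `T* : ℬ → 𝒜` of a linear map `T : 𝒜 → ℬ` with respect to the Hilbert-Schmidt
inner products. -/
noncomputable def hsAdjoint {H K : Type*}
    [NormedAddCommGroup H] [InnerProductSpace ℂ H] [FiniteDimensional ℂ H] [CompleteSpace H]
    [NormedAddCommGroup K] [InnerProductSpace ℂ K] [FiniteDimensional ℂ K] [CompleteSpace K]
    {𝒜 : StarSubalgebra ℂ (H →L[ℂ] H)} {ℬ : StarSubalgebra ℂ (K →L[ℂ] K)}
    (T : 𝒜 →ₗ[ℂ] ℬ) : ℬ →ₗ[ℂ] 𝒜 :=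
  coreAdjoint (hsCore 𝒜) (hsCore ℬ) T

theorem hsAdjoint_spec {H K : Type*}
    [NormedAddCommGroup H] [InnerProductSpace ℂ H] [FiniteDimensional ℂ H] [CompleteSpace H]
    [NormedAddCommGroup K] [InnerProductSpace ℂ K] [FiniteDimensional ℂ K] [CompleteSpace K]
    {𝒜 : StarSubalgebra ℂ (H →L[ℂ] H)} {ℬ : StarSubalgebra ℂ (K →L[ℂ] K)}
    (T : 𝒜 →ₗ[ℂ] ℬ) (b : ℬ) (a : 𝒜) :
    opTrace (star (hsAdjoint T b : H →L[ℂ] H) * (a : H →L[ℂ] H)) =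
      opTrace (star (b : K →L[ℂ] K) * (T a : K →L[ℂ] K)) :=
  coreAdjoint_spec (hsCore 𝒜) (hsCore ℬ) T b a

/-- `Φ` is unital and satisfies the Schwarz inequality `Φ(a)* Φ(a) ≤ Φ(a* a)`, in the
operator order. -/
def IsUnitalSchwarz {H K : Type*}
    [NormedAddCommGroup H] [InnerProductSpace ℂ H] [CompleteSpace H]
    [NormedAddCommGroup K] [InnerProductSpace ℂ K] [CompleteSpace K]
    {𝒜 : StarSubalgebra ℂ (H →L[ℂ] H)} {ℬ : StarSubalgebra ℂ (K →L[ℂ] K)}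
    (Φ : 𝒜 →ₗ[ℂ] ℬ) : Prop :=
  Φ 1 = 1 ∧
    ∀ a : 𝒜, ((star (Φ a) * Φ a : ℬ) : K →L[ℂ] K) ≤ (Φ (star a * a) : K →L[ℂ] K)

/-- The set `𝒮(𝒜)` of density operators in `𝒜`. -/
def densities {H : Type*} [NormedAddCommGroup H] [InnerProductSpace ℂ H] [CompleteSpace H]
    (𝒜 : StarSubalgebra ℂ (H →L[ℂ] H)) : Set 𝒜 :=
  {σ | 0 ≤ (σ : H →L[ℂ] H) ∧ opTrace (σ : H →L[ℂ] H) = 1}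

/-- The support projection of a positive operator: the orthogonal projection onto `(ker a)ᗮ`,
that is, the smallest projection `p` with `a p = a`. -/
noncomputable def supp {H : Type*} [NormedAddCommGroup H] [InnerProductSpace ℂ H]
    [FiniteDimensional ℂ H] (a : H →L[ℂ] H) : H →L[ℂ] H :=
  (LinearMap.ker (a : H →ₗ[ℂ] H))ᗮ.starProjection

/-- The corner `p 𝒜 p`, for a projection `p ∈ 𝒜`. -/
def corner {H : Type*} [NormedAddCommGroup H] [InnerProductSpace ℂ H] [CompleteSpace H]
    (𝒜 : StarSubalgebra ℂ (H →L[ℂ] H)) (p : H →L[ℂ] H) : Set 𝒜 :=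
  {a | ∃ b : 𝒜, (a : H →L[ℂ] H) = p * (b : H →L[ℂ] H) * p}

/-- `a^{-1/2}` for positive `a`, with the inverse taken on the support of `a`: the function is
`x ↦ x^{-1/2}` for `x > 0` and `0 ↦ 0`. -/
noncomputable def invSqrt {H : Type*} [NormedAddCommGroup H] [InnerProductSpace ℂ H]
    [CompleteSpace H] (a : H →L[ℂ] H) : H →L[ℂ] H :=
  cfc (fun x : ℝ => (√x)⁻¹) a

theorem isClosed_coe {H : Type*} [NormedAddCommGroup H] [InnerProductSpace ℂ H]
    [FiniteDimensional ℂ H] [CompleteSpace H] (𝒜 : StarSubalgebra ℂ (H →L[ℂ] H)) :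
    IsClosed (𝒜 : Set (H →L[ℂ] H)) :=
  (Subalgebra.toSubmodule 𝒜.toSubalgebra).closed_of_finiteDimensional

theorem sqrt_mem {H : Type*} [NormedAddCommGroup H] [InnerProductSpace ℂ H]
    [FiniteDimensional ℂ H] [CompleteSpace H] {𝒜 : StarSubalgebra ℂ (H →L[ℂ] H)}
    {a : H →L[ℂ] H} (ha : a ∈ 𝒜) : CFC.sqrt a ∈ 𝒜 := by
  by_cases h : 0 ≤ a
  · have : IsClosed (𝒜 : Set (H →L[ℂ] H)) := isClosed_coe 𝒜
    rw [CFC.sqrt_eq_real_sqrt a]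
    exact cfcₙ_mem _ ha
  · rw [CFC.sqrt_of_not_nonneg h]
    exact zero_mem 𝒜

theorem invSqrt_mem {H : Type*} [NormedAddCommGroup H] [InnerProductSpace ℂ H]
    [FiniteDimensional ℂ H] [CompleteSpace H] {𝒜 : StarSubalgebra ℂ (H →L[ℂ] H)}
    {a : H →L[ℂ] H} (ha : a ∈ 𝒜) : invSqrt a ∈ 𝒜 := by
  have : IsClosed (𝒜 : Set (H →L[ℂ] H)) := isClosed_coe 𝒜
  exact cfc_mem _ ha

/-- `σ^{1/2}` as an element of `𝒜`. -/
noncomputable def sqrtIn {H : Type*} [NormedAddCommGroup H] [InnerProductSpace ℂ H]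
    [FiniteDimensional ℂ H] [CompleteSpace H] {𝒜 : StarSubalgebra ℂ (H →L[ℂ] H)}
    (σ : 𝒜) : 𝒜 :=
  ⟨CFC.sqrt (σ : H →L[ℂ] H), sqrt_mem σ.2⟩

/-- `σ^{-1/2}` (inverse on the support) as an element of `𝒜`. -/
noncomputable def invSqrtIn {H : Type*} [NormedAddCommGroup H] [InnerProductSpace ℂ H]
    [FiniteDimensional ℂ H] [CompleteSpace H] {𝒜 : StarSubalgebra ℂ (H →L[ℂ] H)}
    (σ : 𝒜) : 𝒜 :=
  ⟨invSqrt (σ : H →L[ℂ] H), invSqrt_mem σ.2⟩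

/-- The formula `b ↦ T(σ)^{-1/2} T(σ^{1/2} b σ^{1/2}) T(σ)^{-1/2}`, on all of `𝒜`. The map
`T_σ : p 𝒜 p → p₀ ℬ p₀`, with `p = supp σ` and `p₀ = supp T(σ)`, is its restriction to the corner
`p 𝒜 p`; for invertible `σ` one has `p 𝒜 p = 𝒜`, so it is `T_σ` itself. -/
noncomputable def petz {H K : Type*}
    [NormedAddCommGroup H] [InnerProductSpace ℂ H] [FiniteDimensional ℂ H] [CompleteSpace H]
    [NormedAddCommGroup K] [InnerProductSpace ℂ K] [FiniteDimensional ℂ K] [CompleteSpace K]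
    {𝒜 : StarSubalgebra ℂ (H →L[ℂ] H)} {ℬ : StarSubalgebra ℂ (K →L[ℂ] K)}
    (T : 𝒜 →ₗ[ℂ] ℬ) (σ : 𝒜) : 𝒜 →ₗ[ℂ] ℬ where
  toFun b := invSqrtIn (T σ) * T (sqrtIn σ * b * sqrtIn σ) * invSqrtIn (T σ)
  map_add' a b := by simp only [mul_add, add_mul, map_add]
  map_smul' c a := by
    simp only [mul_smul_comm, smul_mul_assoc, map_smul, RingHom.id_apply]

/-- `T` is reversible for `𝒮`: some `S : ℬ → 𝒜` whose adjoint is a unital Schwarz map satisfies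
`S (T σ) = σ` for all `σ ∈ 𝒮`. -/
def IsReversible {H K : Type*}
    [NormedAddCommGroup H] [InnerProductSpace ℂ H] [FiniteDimensional ℂ H] [CompleteSpace H]
    [NormedAddCommGroup K] [InnerProductSpace ℂ K] [FiniteDimensional ℂ K] [CompleteSpace K]
    {𝒜 : StarSubalgebra ℂ (H →L[ℂ] H)} {ℬ : StarSubalgebra ℂ (K →L[ℂ] K)}
    (T : 𝒜 →ₗ[ℂ] ℬ) (𝒮 : Set 𝒜) : Prop :=
  ∃ S : ℬ →ₗ[ℂ] 𝒜, IsUnitalSchwarz (hsAdjoint S) ∧ ∀ σ ∈ 𝒮, S (T σ) = σ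

end PetzRecovery

namespace PetzRecovery

open scoped ComplexOrder

section HilbertSpace

variable {𝕜 V W : Type*} [RCLike 𝕜] [NormedAddCommGroup V] [InnerProductSpace 𝕜 V]
  [NormedAddCommGroup W] [InnerProductSpace 𝕜 W]

theorem re_inner_apply_le_of_eigenvalue_le_one [FiniteDimensional 𝕜 V] {P : V →ₗ[𝕜] V}
    (hP : P.IsSymmetric) (h : ∀ (c : ℝ) (v : V), v ≠ 0 → P v = (c : 𝕜) • v → c ≤ 1) (v : V) :
    RCLike.re (inner 𝕜 v (P v)) ≤ ‖v‖ ^ 2 := by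
  set b := hP.eigenvectorBasis rfl
  set e := hP.eigenvalues rfl
  have hb (i) : P (b i) = (e i : 𝕜) • b i := hP.apply_eigenvectorBasis rfl i
  have hterm (i) :
      RCLike.re (inner 𝕜 v (b i) * inner 𝕜 (b i) (P v)) = e i * ‖inner 𝕜 (b i) v‖ ^ 2 := by
    rw [← hP, hb, inner_smul_left, RCLike.conj_ofReal, mul_left_comm, RCLike.re_ofReal_mul,
      inner_mul_symm_re_eq_norm, norm_mul, norm_inner_symm v, sq]
  rw [← b.sum_inner_mul_inner, map_sum, ← b.sum_sq_norm_inner_right]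
  refine Finset.sum_le_sum fun i _ => ?_
  rw [hterm]
  exact mul_le_of_le_one_left (by positivity) (h _ (b i) (b.orthonormal.ne_zero i) (hb i))

theorem norm_apply_le_of_eigenvalue_le_one [FiniteDimensional 𝕜 V] {β : V →ₗ[𝕜] W} {α : W →ₗ[𝕜] V}
    (hadj : ∀ v w, inner 𝕜 v (α w) = inner 𝕜 (β v) w)
    (h : ∀ (c : ℝ) (v : V), v ≠ 0 → α (β v) = (c : 𝕜) • v → c ≤ 1) (v : V) : ‖β v‖ ≤ ‖v‖ := by
  have hsymm : (α ∘ₗ β).IsSymmetric := fun x y => by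
    rw [LinearMap.comp_apply, LinearMap.comp_apply, hadj, ← inner_conj_symm, hadj, inner_conj_symm]
  have hle := re_inner_apply_le_of_eigenvalue_le_one hsymm h v
  rw [LinearMap.comp_apply, hadj, inner_self_eq_norm_sq] at hle
  exact (sq_le_sq₀ (norm_nonneg _) (norm_nonneg _)).1 hle

theorem norm_adjoint_apply_le {β : V →ₗ[𝕜] W} {α : W →ₗ[𝕜] V}
    (hadj : ∀ v w, inner 𝕜 v (α w) = inner 𝕜 (β v) w) (hβ : ∀ v, ‖β v‖ ≤ ‖v‖) (w : W) :
    ‖α w‖ ≤ ‖w‖ := by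
  have h : ‖α w‖ ^ 2 ≤ ‖α w‖ * ‖w‖ := calc
    ‖α w‖ ^ 2 = RCLike.re (inner 𝕜 (β (α w)) w) := by rw [← hadj, inner_self_eq_norm_sq]
    _ ≤ ‖β (α w)‖ * ‖w‖ := re_inner_le_norm _ _
    _ ≤ ‖α w‖ * ‖w‖ := by gcongr; exact hβ _
  nlinarith [norm_nonneg (α w), norm_nonneg w]

theorem adjoint_apply_eq_of_left_inverse_at {β γ : V →ₗ[𝕜] W} {α δ : W →ₗ[𝕜] V}
    (hα : ∀ v w, inner 𝕜 v (α w) = inner 𝕜 (β v) w)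
    (hδ : ∀ v w, inner 𝕜 v (δ w) = inner 𝕜 (γ v) w)
    (hβ : ∀ v, ‖β v‖ ≤ ‖v‖) (hγ : ∀ v, ‖γ v‖ ≤ ‖v‖) {d : V} (hd : δ (β d) = d) :
    α (β d) = d := by
  have hnorm : ‖β d‖ = ‖d‖ := (hβ d).antisymm <| calc
    ‖d‖ = ‖δ (β d)‖ := by rw [hd]
    _ ≤ ‖β d‖ := norm_adjoint_apply_le hδ hγ _
  refine eq_of_norm_le_re_inner_eq_norm_sq (𝕜 := 𝕜) ?_ ?_
  · exact (norm_adjoint_apply_le hα hβ _).trans hnorm.le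
  · rw [inner_re_symm, hα, inner_self_eq_norm_sq, hnorm]

theorem apply_eq_sqrt_smul_of_apply_apply_eq {M : V →ₗ[𝕜] V} (hM : M.IsPositive) {c : ℝ} {x : V}
    (hx : M (M x) = (c : 𝕜) • x) : M x = (√c : 𝕜) • x := by
  rcases le_or_gt c 0 with hc | hc
  · have hnorm : ‖M x‖ ^ 2 = c * ‖x‖ ^ 2 := by
      rw [← inner_self_eq_norm_sq (𝕜 := 𝕜), hM.isSymmetric, hx, inner_smul_right,
        RCLike.re_ofReal_mul, inner_self_eq_norm_sq]
    have hzero : ‖M x‖ ^ 2 = 0 := by nlinarith [sq_nonneg ‖M x‖, sq_nonneg ‖x‖]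
    simpa [Real.sqrt_eq_zero_of_nonpos hc] using hzero
  -- `M` maps `y = M x - √c x` to `-√c y`, so positivity forces `y = 0`.
  · have hsq : (√c : 𝕜) * (√c : 𝕜) = c := by rw [← RCLike.ofReal_mul, Real.mul_self_sqrt hc.le]
    set y := M x - (√c : 𝕜) • x with hy
    have hMy : M y = -((√c : 𝕜) • y) := by
      rw [hy, map_sub, map_smul, hx, smul_sub, smul_smul, hsq, neg_sub]
    have hnonneg := hM.re_inner_nonneg_right y
    rw [hMy, inner_neg_right, inner_smul_right, map_neg, RCLike.re_ofReal_mul,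
      inner_self_eq_norm_sq] at hnonneg
    have hnorm : ‖y‖ ^ 2 = 0 := by nlinarith [sq_nonneg ‖y‖, Real.sqrt_pos.2 hc]
    exact sub_eq_zero.1 (norm_eq_zero.1 (pow_eq_zero_iff two_ne_zero |>.1 hnorm))

theorem le_of_forall_eigenvector_mem [FiniteDimensional 𝕜 V] {L : V →ₗ[𝕜] V} (hL : L.IsSymmetric)
    {D p : Submodule 𝕜 V} (hD : ∀ x ∈ D, L x ∈ D)
    (hp : ∀ (c : ℝ), ∀ x ∈ D, L x = (c : 𝕜) • x → x ∈ p) : D ≤ p := by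
  have hR := hL.restrict_invariant hD
  set b := hR.eigenvectorBasis rfl
  intro x hx
  have hsum : x = ∑ i, b.repr ⟨x, hx⟩ i • (b i : V) := by
    simpa using (congrArg D.subtype (b.sum_repr ⟨x, hx⟩)).symm
  rw [hsum]
  refine p.sum_mem fun i _ => p.smul_mem _ (hp (hR.eigenvalues rfl i) _ (b i).2 ?_)
  exact congrArg Subtype.val (hR.apply_eigenvectorBasis rfl i)

theorem map_apply_of_map_apply_apply [FiniteDimensional 𝕜 V] {M : V →ₗ[𝕜] V} {M' : W →ₗ[𝕜] W}
    (hM : M.IsPositive) (hM' : M'.IsPositive) {β : V →ₗ[𝕜] W} {D : Submodule 𝕜 V}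
    (hD : ∀ x ∈ D, M (M x) ∈ D) (hβ : ∀ x ∈ D, β (M (M x)) = M' (M' (β x))) {x : V} (hx : x ∈ D) :
    M x ∈ D ∧ β (M x) = M' (β x) := by
  have hMM : (M ∘ₗ M).IsSymmetric := fun x y => by
    rw [LinearMap.comp_apply, LinearMap.comp_apply, hM.isSymmetric, hM.isSymmetric]
  suffices D ≤ D.comap M ⊓ LinearMap.eqLocus (β ∘ₗ M) (M' ∘ₗ β) from this hx
  refine le_of_forall_eigenvector_mem hMM hD fun c x hx hc => ?_
  have hMx := apply_eq_sqrt_smul_of_apply_apply_eq hM hc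
  have hM'x : M' (β x) = (√c : 𝕜) • β x :=
    apply_eq_sqrt_smul_of_apply_apply_eq hM' (by rw [← hβ x hx, ← map_smul]; exact congrArg β hc)
  refine ⟨?_, ?_⟩
  · rw [SetLike.mem_coe, Submodule.mem_comap, hMx]
    exact D.smul_mem _ hx
  · change β (M x) = M' (β x)
    rw [hMx, map_smul, hM'x]

end HilbertSpace

theorem isPositive_of_forall_inner_nonneg {V : Type*} [NormedAddCommGroup V]
    [InnerProductSpace ℂ V] {M : V →ₗ[ℂ] V} (hM : ∀ x, 0 ≤ inner ℂ (M x) x) : M.IsPositive :=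
  (LinearMap.isPositive_iff_complex M).2 fun x =>
    ⟨(Complex.eq_re_of_ofReal_le (hM x)).symm, (Complex.nonneg_iff.1 (hM x)).1⟩

section Core

variable {V W : Type*} [AddCommGroup V] [Module ℂ V] [FiniteDimensional ℂ V] [AddCommGroup W]
  [Module ℂ W] (cV : InnerProductSpace.Core ℂ V) (cW : InnerProductSpace.Core ℂ W)

theorem core_adjoint_apply_eq_of_left_inverse_at {β γ : V →ₗ[ℂ] W} {α δ : W →ₗ[ℂ] V}
    (hα : ∀ v w, cV.inner v (α w) = cW.inner (β v) w)
    (hδ : ∀ v w, cV.inner v (δ w) = cW.inner (γ v) w)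
    (hαβ : ∀ (c : ℝ) (v : V), v ≠ 0 → α (β v) = (c : ℂ) • v → c ≤ 1)
    (hδγ : ∀ (c : ℝ) (v : V), v ≠ 0 → δ (γ v) = (c : ℂ) • v → c ≤ 1) {d : V}
    (hd : δ (β d) = d) : α (β d) = d :=
  letI : NormedAddCommGroup V := cV.toNormedAddCommGroup
  letI : InnerProductSpace ℂ V := .ofCore cV.toCore
  letI : NormedAddCommGroup W := cW.toNormedAddCommGroup
  letI : InnerProductSpace ℂ W := .ofCore cW.toCore
  adjoint_apply_eq_of_left_inverse_at hα hδ (norm_apply_le_of_eigenvalue_le_one hα hαβ)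
    (norm_apply_le_of_eigenvalue_le_one hδ hδγ) hd

theorem core_map_apply_of_map_apply_apply {M : V →ₗ[ℂ] V} {M' : W →ₗ[ℂ] W}
    (hM : ∀ x, 0 ≤ cV.inner (M x) x) (hM' : ∀ y, 0 ≤ cW.inner (M' y) y) {β : V →ₗ[ℂ] W}
    {D : Submodule ℂ V} (hD : ∀ x ∈ D, M (M x) ∈ D)
    (hβ : ∀ x ∈ D, β (M (M x)) = M' (M' (β x))) {x : V} (hx : x ∈ D) :
    M x ∈ D ∧ β (M x) = M' (β x) :=
  letI : NormedAddCommGroup V := cV.toNormedAddCommGroup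
  letI : InnerProductSpace ℂ V := .ofCore cV.toCore
  letI : NormedAddCommGroup W := cW.toNormedAddCommGroup
  letI : InnerProductSpace ℂ W := .ofCore cW.toCore
  map_apply_of_map_apply_apply (isPositive_of_forall_inner_nonneg hM)
    (isPositive_of_forall_inner_nonneg hM') hD hβ hx

end Core

section OrderedModule

theorem nonneg_of_forall_nonneg_add_smul {E : Type*} [AddCommGroup E] [PartialOrder E]
    [IsOrderedAddMonoid E] [Module ℝ E] [PosSMulMono ℝ E] [TopologicalSpace E] [ContinuousAdd E]
    [ContinuousSMul ℝ E] [OrderClosedTopology E] {p x : E} (h : ∀ t : ℝ, 0 < t → 0 ≤ p + t • x) :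
    0 ≤ x := by
  have hlim : Filter.Tendsto (fun t : ℝ => t⁻¹ • p + x) Filter.atTop (nhds (0 + x)) := by
    have := (tendsto_inv_atTop_zero (𝕜 := ℝ)).smul_const p
    rw [zero_smul] at this
    exact this.add_const x
  rw [zero_add] at hlim
  refine ge_of_tendsto hlim ?_
  filter_upwards [Filter.eventually_gt_atTop 0] with t ht
  have := smul_nonneg (inv_nonneg.2 ht.le) (h t ht)
  rwa [smul_add, inv_smul_smul₀ ht.ne'] at this

theorem apply_eq_zero_of_apply_self_eq_zero {V E : Type*} [AddCommGroup V] [Module ℂ V]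
    [AddCommGroup E] [PartialOrder E] [IsOrderedAddMonoid E] [Module ℂ E] [PosSMulMono ℝ E]
    [TopologicalSpace E] [ContinuousAdd E] [ContinuousSMul ℝ E] [OrderClosedTopology E]
    {D : V →ₗ⋆[ℂ] V →ₗ[ℂ] E} (hD : ∀ x, 0 ≤ D x x) {v : V} (hv : D v v = 0) (w : V) :
    D w v = 0 := by
  have hexpand (u : V) (t : ℝ) : D (u + (t : ℂ) • v) (u + (t : ℂ) • v) =
      D u u + t • (D u v + D v u) := by
    simp only [map_add, LinearMap.map_smulₛₗ, LinearMap.add_apply, LinearMap.smul_apply, hv,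
      Complex.conj_ofReal, RingHom.id_apply, smul_zero, ← Complex.coe_smul]
    module
  have hre (u : V) : D u v + D v u = 0 := by
    refine le_antisymm (neg_nonneg.1 ?_) ?_
    · refine nonneg_of_forall_nonneg_add_smul (p := D u u) fun t _ => ?_
      rw [smul_neg, ← neg_smul, ← hexpand]
      exact hD _
    · refine nonneg_of_forall_nonneg_add_smul (p := D u u) fun t _ => ?_
      rw [← hexpand]
      exact hD _
  have him := hre (Complex.I • w)
  simp only [LinearMap.map_smulₛₗ, LinearMap.smul_apply, RingHom.id_apply, Complex.conj_I] at him
  have htwo : (2 : ℂ) • D w v = 0 := by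
    linear_combination (norm := skip) hre w + Complex.I • him
    simp only [smul_add, smul_smul, neg_smul, smul_neg, Complex.I_mul_I]
    module
  exact (smul_eq_zero.1 htwo).resolve_left two_ne_zero

end OrderedModule

/-- A faithful positive tracial functional, which stands for `Tr` on an abstract *-algebra. -/
structure IsFaithfulTrace {A : Type*} [Ring A] [StarRing A] [Algebra ℂ A] (τ : A →ₗ[ℂ] ℂ) :
    Prop where
  mul_comm : ∀ a b, τ (a * b) = τ (b * a)
  map_star : ∀ a, τ (star a) = star (τ a)
  nonneg : ∀ a, 0 ≤ τ (star a * a)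
  faithful : ∀ a, τ (star a * a) = 0 → a = 0

namespace IsFaithfulTrace

section Ring

variable {A : Type*} [Ring A] [StarRing A] [Algebra ℂ A] {τ : A →ₗ[ℂ] ℂ}

theorem ext_apply_mul (hτ : IsFaithfulTrace τ) {x y : A} (h : ∀ a, τ (a * x) = τ (a * y)) :
    x = y := by
  refine sub_eq_zero.1 (hτ.faithful _ ?_)
  rw [mul_sub, map_sub, h, sub_self]

theorem apply_mul_mul_mul_comm (hτ : IsFaithfulTrace τ) (r a b : A) :
    τ (r * a * r * b) = τ (r * b * r * a) := by
  rw [mul_assoc, hτ.mul_comm, ← mul_assoc]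

end Ring

variable {A : Type*} [CStarAlgebra A] [PartialOrder A] [StarOrderedRing A] {τ : A →ₗ[ℂ] ℂ}

theorem apply_nonneg (hτ : IsFaithfulTrace τ) {a : A} (ha : 0 ≤ a) : 0 ≤ τ a := by
  obtain ⟨x, rfl⟩ := CStarAlgebra.nonneg_iff_eq_star_mul_self.1 ha
  exact hτ.nonneg x

theorem apply_mul_nonneg (hτ : IsFaithfulTrace τ) {a b : A} (ha : 0 ≤ a) (hb : 0 ≤ b) :
    0 ≤ τ (a * b) := by
  obtain ⟨x, rfl⟩ := CStarAlgebra.nonneg_iff_eq_star_mul_self.1 ha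
  rw [mul_assoc, hτ.mul_comm]
  exact hτ.apply_nonneg (star_right_conjugate_nonneg hb x)

theorem mul_eq_zero_of_apply_eq_zero (hτ : IsFaithfulTrace τ) {a b : A} (ha : 0 ≤ a) (hb : 0 ≤ b)
    (h : τ (a * b) = 0) : a * b = 0 := by
  obtain ⟨x, rfl⟩ := CStarAlgebra.nonneg_iff_eq_star_mul_self.1 ha
  obtain ⟨y, rfl⟩ := CStarAlgebra.nonneg_iff_eq_star_mul_self.1 hb
  have hxy : x * star y = 0 := hτ.faithful _ <| by
    rw [← h, star_mul, star_star, mul_assoc, hτ.mul_comm]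
    simp only [mul_assoc]
  rw [mul_assoc, ← mul_assoc x, hxy, zero_mul, mul_zero]

theorem isSelfAdjoint_of_apply_mul_nonneg (hτ : IsFaithfulTrace τ) {x : A}
    (h : ∀ a, 0 ≤ a → 0 ≤ τ (a * x)) : IsSelfAdjoint x := by
  have hext : τ ∘ₗ LinearMap.mulRight ℂ (star x) = τ ∘ₗ LinearMap.mulRight ℂ x := by
    refine LinearMap.ext_on CStarAlgebra.span_nonneg fun a (ha : 0 ≤ a) => ?_
    rw [LinearMap.comp_apply, LinearMap.comp_apply, LinearMap.mulRight_apply,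
      LinearMap.mulRight_apply, hτ.mul_comm, ← (h a ha).star_eq, ← hτ.map_star, star_mul,
      ha.star_eq]
  exact hτ.ext_apply_mul fun a => LinearMap.congr_fun hext a

theorem nonneg_of_apply_mul_nonneg (hτ : IsFaithfulTrace τ) {x : A}
    (h : ∀ a, 0 ≤ a → 0 ≤ τ (a * x)) : 0 ≤ x := by
  have hx := hτ.isSelfAdjoint_of_apply_mul_nonneg h
  have hmul : x⁻ * x = -(star x⁻ * x⁻) := by
    nth_rw 2 [← CFC.posPart_sub_negPart x]
    rw [mul_sub, CFC.negPart_mul_posPart, (CFC.negPart_nonneg x).star_eq, zero_sub]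
  have hle := h _ (CFC.negPart_nonneg x)
  rw [hmul, map_neg, neg_nonneg] at hle
  exact (CFC.negPart_eq_zero_iff x).1 (hτ.faithful _ (hle.antisymm (hτ.nonneg _)))

theorem map_nonneg_of_adjoint {B : Type*} [CStarAlgebra B] [PartialOrder B] [StarOrderedRing B]
    {τB : B →ₗ[ℂ] ℂ} (hτ : IsFaithfulTrace τ) (hB : IsFaithfulTrace τB) {γ : A →ₗ[ℂ] B}
    {S : B →ₗ[ℂ] A} (hγ : ∀ a, 0 ≤ a → 0 ≤ γ a) (hS : ∀ a b, τB (γ a * b) = τ (a * S b)) {b : B}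
    (hb : 0 ≤ b) : 0 ≤ S b :=
  hτ.nonneg_of_apply_mul_nonneg fun a ha => hS a b ▸ hB.apply_mul_nonneg (hγ a ha) hb

theorem eq_zero_of_apply_conj_eq_zero (hτ : IsFaithfulTrace τ) {r : Aˣ} (hr : 0 ≤ (r : A)) {x : A}
    (hx : 0 ≤ x) (h : τ (r * x * r) = 0) : x = 0 := by
  have hrr : (0 : A) ≤ r * r := by simpa only [hr.star_eq] using star_mul_self_nonneg (r : A)
  rw [hτ.mul_comm, ← mul_assoc] at h
  simpa [mul_assoc] using hτ.mul_eq_zero_of_apply_eq_zero hrr hx h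

theorem eq_zero_of_apply_mul_star_mul_mul_eq_zero (hτ : IsFaithfulTrace τ) {r : Aˣ}
    (hr : 0 ≤ (r : A)) {x : A} (h : τ (r * star x * r * x) = 0) : x = 0 := by
  have hconj : star x * r * x = 0 := by
    simp only [mul_assoc] at h
    simpa [mul_assoc] using
      hτ.mul_eq_zero_of_apply_eq_zero hr (star_left_conjugate_nonneg hr x) (by simpa [mul_assoc])
  have hmul : (r : A) * (x * star x) = 0 := by
    refine hτ.mul_eq_zero_of_apply_eq_zero hr (mul_star_self_nonneg x) ?_
    rw [← mul_assoc, hτ.mul_comm, ← mul_assoc, hconj, map_zero]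
  rwa [Units.mul_right_eq_zero, CStarRing.mul_star_self_eq_zero_iff] at hmul

/-- The KMS inner product `⟨x, y⟩ = τ (r x* r y)` of the positive functional `τ (r² ·)`; for
`r = 1` it is the Hilbert–Schmidt inner product. -/
noncomputable abbrev kmsCore (hτ : IsFaithfulTrace τ) (r : Aˣ) (hr : 0 ≤ (r : A)) :
    InnerProductSpace.Core ℂ A where
  inner x y := τ (r * star x * r * y)
  conj_inner_symm x y := by
    rw [starRingEnd_apply, ← hτ.map_star, hτ.apply_mul_mul_mul_comm r (star x), hτ.mul_comm]
    simp only [star_mul, star_star, hr.star_eq, mul_assoc]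
  re_inner_nonneg x := by
    have := hτ.apply_mul_nonneg hr (star_left_conjugate_nonneg hr x)
    simp only [← mul_assoc] at this
    exact (Complex.nonneg_iff.1 this).1
  add_left x y z := by simp only [star_add, mul_add, add_mul, map_add]
  smul_left x y c := by simp
  definite x h := hτ.eq_zero_of_apply_mul_star_mul_mul_eq_zero hr h

end IsFaithfulTrace

section StarAlgebra

variable {A B C : Type*} [Ring A] [Algebra ℂ A] [Ring B] [Algebra ℂ B]

/-- A positive unital linear map. Every real eigenvalue of such a map is at most `1`, which is how
these maps become contractions for the KMS norms. -/
structure IsPositiveUnital [PartialOrder A] [PartialOrder B] (Φ : A →ₗ[ℂ] B) : Prop where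
  map_one : Φ 1 = 1
  map_nonneg : ∀ {a}, 0 ≤ a → 0 ≤ Φ a

theorem IsPositiveUnital.comp [Ring C] [Algebra ℂ C] [PartialOrder A] [PartialOrder B]
    [PartialOrder C] {Ψ : B →ₗ[ℂ] C} {Φ : A →ₗ[ℂ] B}
    (hΨ : IsPositiveUnital Ψ) (hΦ : IsPositiveUnital Φ) : IsPositiveUnital (Ψ ∘ₗ Φ) where
  map_one := by rw [LinearMap.comp_apply, hΦ.map_one, hΨ.map_one]
  map_nonneg ha := hΨ.map_nonneg (hΦ.map_nonneg ha)

variable [StarRing A] [StarRing B]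

/-- A unital linear map satisfying the Schwarz inequality `Φ(a)* Φ(a) ≤ Φ(a* a)`. Unlike in
`IsUnitalSchwarz`, the algebras are abstract. -/
structure IsSchwarzMap [PartialOrder B] (Φ : A →ₗ[ℂ] B) : Prop where
  map_one : Φ 1 = 1
  le_map : ∀ a, star (Φ a) * Φ a ≤ Φ (star a * a)

/-- The sesquilinear form `(a, b) ↦ Φ(a* b) - Φ(a)* Φ(b)`, which measures the failure of `Φ` to be
multiplicative. -/
noncomputable def schwarzDefect [StarModule ℂ A] [StarModule ℂ B] (Φ : A →ₗ[ℂ] B) :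
    A →ₗ⋆[ℂ] A →ₗ[ℂ] B :=
  LinearMap.mk₂'ₛₗ (starRingEnd ℂ) (RingHom.id ℂ) (fun a b => Φ (star a * b) - star (Φ a) * Φ b)
    (fun a a' b => by simp only [star_add, add_mul, map_add]; abel)
    (fun c a b => by simp [smul_sub])
    (fun a b b' => by simp only [mul_add, map_add]; abel)
    (fun c a b => by simp [smul_sub])

theorem schwarzDefect_apply [StarModule ℂ A] [StarModule ℂ B] (Φ : A →ₗ[ℂ] B) (a b : A) :
    schwarzDefect Φ a b = Φ (star a * b) - star (Φ a) * Φ b := rfl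

theorem IsSchwarzMap.schwarzDefect_nonneg [StarModule ℂ A] [StarModule ℂ B] [PartialOrder B]
    [IsOrderedAddMonoid B] {Φ : A →ₗ[ℂ] B} (hΦ : IsSchwarzMap Φ) (a : A) :
    0 ≤ schwarzDefect Φ a a :=
  sub_nonneg.2 (hΦ.le_map a)

end StarAlgebra

theorem norm_le_of_neg_le_of_le {A : Type*} [CStarAlgebra A] [PartialOrder A] [StarOrderedRing A]
    {x : A} (hx : IsSelfAdjoint x) {c : ℝ} (hc : 0 ≤ c) (hneg : -algebraMap ℝ A c ≤ x)
    (hle : x ≤ algebraMap ℝ A c) : ‖x‖ ≤ c := by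
  cases subsingleton_or_nontrivial A with
  | inl h => simpa [Subsingleton.elim x 0] using hc
  | inr h =>
    rw [← map_neg, algebraMap_le_iff_le_spectrum] at hneg
    rw [le_algebraMap_iff_spectrum_le] at hle
    rcases CStarAlgebra.norm_or_neg_norm_mem_spectrum hx with hmem | hmem
    · exact hle _ hmem
    · linarith [hneg _ hmem]

section CStarAlgebra

variable {A B : Type*} [CStarAlgebra A] [PartialOrder A] [StarOrderedRing A]
  [CStarAlgebra B] [PartialOrder B] [StarOrderedRing B] {Φ : A →ₗ[ℂ] B}

namespace IsPositiveUnital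

theorem map_star (hΦ : IsPositiveUnital Φ) (a : A) : Φ (star a) = star (Φ a) :=
  StarHomClass.map_star (PositiveLinearMap.mk₀ Φ fun _ => hΦ.map_nonneg) a

theorem norm_map_le_of_isSelfAdjoint (hΦ : IsPositiveUnital Φ) {x : A} (hx : IsSelfAdjoint x) :
    ‖Φ x‖ ≤ ‖x‖ := by
  have hmap : Φ (algebraMap ℝ A ‖x‖) = algebraMap ℝ B ‖x‖ := by
    rw [Algebra.algebraMap_eq_smul_one, Algebra.algebraMap_eq_smul_one, ← Complex.coe_smul,
      map_smul, hΦ.map_one, Complex.coe_smul]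
  have hmono : Monotone Φ := (PositiveLinearMap.mk₀ Φ fun _ => hΦ.map_nonneg).monotone'
  refine norm_le_of_neg_le_of_le ?_ (norm_nonneg x) ?_ ?_
  · rw [IsSelfAdjoint, ← hΦ.map_star, hx.star_eq]
  · simpa only [map_neg, hmap] using hmono hx.neg_algebraMap_norm_le_self
  · simpa only [hmap] using hmono hx.le_algebraMap_norm_self

theorem eigenvalue_le_one {P : A →ₗ[ℂ] A} (hP : IsPositiveUnital P) {c : ℝ} {v : A} (hv : v ≠ 0)
    (hc : P v = (c : ℂ) • v) : c ≤ 1 := by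
  have hself (x : A) (hx : IsSelfAdjoint x) (hx0 : x ≠ 0) (hcx : P x = (c : ℂ) • x) : c ≤ 1 := by
    have hle := hP.norm_map_le_of_isSelfAdjoint hx
    rw [hcx, norm_smul, Complex.norm_real] at hle
    exact (le_abs_self c).trans ((mul_le_iff_le_one_left (norm_pos_iff.2 hx0)).1 hle)
  have hstar : P (star v) = (c : ℂ) • star v := by
    rw [hP.map_star, hc, star_smul, Complex.star_def, Complex.conj_ofReal]
  by_cases hzero : v + star v = 0
  · refine hself (Complex.I • v) ?_ (smul_ne_zero Complex.I_ne_zero hv) ?_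
    · rw [IsSelfAdjoint, star_smul, ← neg_eq_iff_add_eq_zero.2 hzero]
      simp
    · rw [map_smul, hc, smul_comm]
  · refine hself _ ?_ hzero ?_
    · rw [IsSelfAdjoint, star_add, star_star, add_comm]
    · rw [map_add, hc, hstar, smul_add]

end IsPositiveUnital

namespace IsSchwarzMap

theorem isPositiveUnital (hΦ : IsSchwarzMap Φ) : IsPositiveUnital Φ where
  map_one := hΦ.map_one
  map_nonneg ha := by
    obtain ⟨x, rfl⟩ := CStarAlgebra.nonneg_iff_eq_star_mul_self.1 ha
    exact (star_mul_self_nonneg _).trans (hΦ.le_map x)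

theorem map_mul_of_schwarzDefect_eq_zero (hΦ : IsSchwarzMap Φ) {a : A}
    (ha : schwarzDefect Φ a a = 0) (b : A) : Φ (b * a) = Φ b * Φ a := by
  have hb := apply_eq_zero_of_apply_self_eq_zero hΦ.schwarzDefect_nonneg ha (star b)
  rwa [schwarzDefect_apply, sub_eq_zero, star_star, hΦ.isPositiveUnital.map_star,
    star_star] at hb

end IsSchwarzMap

end CStarAlgebra

section KMSPair

variable {A B : Type*} [CStarAlgebra A] [PartialOrder A] [CStarAlgebra B] [PartialOrder B]

/-- Schwarz maps `β : A → B` and `α : B → A` that are adjoint for the KMS inner products given by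
`τA`, `r` and `τB`, `r'`. With `r = ρ^{1/2}` and `r' = T(ρ)^{1/2}` the pair of interest is
`α = T*`, `β = T_ρ`. -/
structure IsKMSPair (τA : A →ₗ[ℂ] ℂ) (τB : B →ₗ[ℂ] ℂ) (r : Aˣ) (r' : Bˣ) (α : B →ₗ[ℂ] A)
    (β : A →ₗ[ℂ] B) : Prop where
  traceA : IsFaithfulTrace τA
  traceB : IsFaithfulTrace τB
  nonnegA : 0 ≤ (r : A)
  nonnegB : 0 ≤ (r' : B)
  schwarzA : IsSchwarzMap α
  schwarzB : IsSchwarzMap β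
  dual : ∀ a b, τA (r * a * r * α b) = τB (r' * β a * r' * b)

namespace IsKMSPair

variable {τA : A →ₗ[ℂ] ℂ} {τB : B →ₗ[ℂ] ℂ} {r : Aˣ} {r' : Bˣ} {α : B →ₗ[ℂ] A} {β : A →ₗ[ℂ] B}

theorem symm (h : IsKMSPair τA τB r r' α β) : IsKMSPair τB τA r' r β α where
  traceA := h.traceB
  traceB := h.traceA
  nonnegA := h.nonnegB
  nonnegB := h.nonnegA
  schwarzA := h.schwarzB
  schwarzB := h.schwarzA
  dual b a := by
    rw [h.traceB.apply_mul_mul_mul_comm, ← h.dual, h.traceA.apply_mul_mul_mul_comm]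

theorem trace_map (h : IsKMSPair τA τB r r' α β) (a : A) : τA (r * a * r) = τB (r' * β a * r') := by
  simpa only [h.schwarzA.map_one, mul_one] using h.dual a 1

variable [StarOrderedRing A] [StarOrderedRing B]

theorem fixed_star (h : IsKMSPair τA τB r r' α β) {d : A} (hd : α (β d) = d) :
    α (β (star d)) = star d := by
  rw [h.schwarzB.isPositiveUnital.map_star, h.schwarzA.isPositiveUnital.map_star, hd]

theorem schwarzDefect_fixed (h : IsKMSPair τA τB r r' α β) {d : A} (hd : α (β d) = d) :
    schwarzDefect β d d = 0 := by
  have hA : 0 ≤ τA (r * (α (star (β d) * β d) - star d * d) * r) := by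
    have hle := h.schwarzA.le_map (β d)
    rw [hd, ← sub_nonneg] at hle
    exact h.traceA.apply_nonneg (h.nonnegA.isSelfAdjoint.conjugate_nonneg hle)
  have hB := h.traceB.apply_nonneg <|
    h.nonnegB.isSelfAdjoint.conjugate_nonneg (h.schwarzB.schwarzDefect_nonneg d)
  have hneg : τB (r' * schwarzDefect β d d * r') =
      -τA (r * (α (star (β d) * β d) - star d * d) * r) := by
    rw [schwarzDefect_apply, mul_sub, sub_mul, map_sub, ← h.trace_map, h.symm.trace_map, mul_sub,
      sub_mul, map_sub, neg_sub]
  refine h.traceB.eq_zero_of_apply_conj_eq_zero h.nonnegB (h.schwarzB.schwarzDefect_nonneg d) ?_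
  exact le_antisymm (hneg ▸ neg_nonpos.2 hA) hB

theorem map_mul_fixed (h : IsKMSPair τA τB r r' α β) {d : A} (hd : α (β d) = d) (a : A) :
    β (a * d) = β a * β d :=
  h.schwarzB.map_mul_of_schwarzDefect_eq_zero (h.schwarzDefect_fixed hd) a

theorem map_fixed_mul (h : IsKMSPair τA τB r r' α β) {d : A} (hd : α (β d) = d) (a : A) :
    β (d * a) = β d * β a := by
  have hstar := h.map_mul_fixed (h.fixed_star hd) (star a)
  simp only [← star_mul, h.schwarzB.isPositiveUnital.map_star] at hstar
  exact star_injective hstar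

theorem fixed_mul (h : IsKMSPair τA τB r r' α β) {d e : A} (hd : α (β d) = d)
    (he : α (β e) = e) : α (β (d * e)) = d * e := by
  rw [h.map_mul_fixed he, h.symm.map_mul_fixed (by rw [he]), hd, he]

theorem map_modular (h : IsKMSPair τA τB r r' α β) {d : A} (hd : α (β d) = d) :
    α (↑r'⁻¹ * β d * r') = ↑r⁻¹ * d * r := by
  refine h.traceA.ext_apply_mul fun a => ?_
  obtain ⟨b, rfl⟩ : ∃ b, r * b * r = a := ⟨↑r⁻¹ * a * ↑r⁻¹, by simp [mul_assoc]⟩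
  calc τA (r * b * r * α (↑r'⁻¹ * β d * r'))
      = τB (r' * (β b * β d) * r') := by rw [h.dual]; simp [mul_assoc]
    _ = τA (r * (b * d) * r) := by rw [← h.map_mul_fixed hd, h.trace_map]
    _ = τA (r * b * r * (↑r⁻¹ * d * r)) := by simp [mul_assoc]

theorem modular (h : IsKMSPair τA τB r r' α β) {d : A} (hd : α (β d) = d) :
    α (β (↑r⁻¹ * d * r)) = ↑r⁻¹ * d * r ∧ β (↑r⁻¹ * d * r) = ↑r'⁻¹ * β d * r' := by
  have hmap := h.symm.map_modular (d := β d) (by rw [hd])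
  rw [hd] at hmap
  exact ⟨by rw [hmap, h.map_modular hd], hmap⟩

end IsKMSPair

variable [StarOrderedRing A] [StarOrderedRing B] {τA : A →ₗ[ℂ] ℂ} {τB : B →ₗ[ℂ] ℂ} {r : Aˣ}
  {r' : Bˣ}

theorem kms_adjoint_apply_eq_of_left_inverse_at [FiniteDimensional ℂ A]
    (hA : IsFaithfulTrace τA) (hB : IsFaithfulTrace τB) (hr : 0 ≤ (r : A)) (hr' : 0 ≤ (r' : B))
    {α δ : B →ₗ[ℂ] A} {β γ : A →ₗ[ℂ] B} (hα : IsPositiveUnital α) (hβ : IsPositiveUnital β)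
    (hγ : IsPositiveUnital γ) (hδ : IsPositiveUnital δ)
    (hβα : ∀ a b, τA (r * a * r * α b) = τB (r' * β a * r' * b))
    (hγδ : ∀ a b, τA (r * a * r * δ b) = τB (r' * γ a * r' * b)) {d : A} (hd : δ (β d) = d) :
    α (β d) = d := by
  have hadj {ε : B →ₗ[ℂ] A} {φ : A →ₗ[ℂ] B} (hφ : IsPositiveUnital φ)
      (h : ∀ a b, τA (r * a * r * ε b) = τB (r' * φ a * r' * b)) (v : A) (w : B) :
      (hA.kmsCore r hr).inner v (ε w) = (hB.kmsCore r' hr').inner (φ v) w :=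
    (h (star v) w).trans (by rw [hφ.map_star]; rfl)
  exact core_adjoint_apply_eq_of_left_inverse_at _ _ (hadj hβ hβα) (hadj hγ hγδ)
    (fun c v => (hα.comp hβ).eigenvalue_le_one) (fun c v => (hδ.comp hγ).eigenvalue_le_one) hd

end KMSPair

section Cocycle

theorem IsFaithfulTrace.kmsCore_one_inner_mulLeftRight_nonneg {A : Type*} [CStarAlgebra A]
    [PartialOrder A] [StarOrderedRing A] {τ : A →ₗ[ℂ] ℂ} (hτ : IsFaithfulTrace τ) {s t : A}
    (hs : 0 ≤ s) (ht : 0 ≤ t) (x : A) :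
    0 ≤ (hτ.kmsCore 1 zero_le_one).inner (LinearMap.mulLeftRight ℂ (s, t) x) x := by
  have hnonneg := hτ.apply_mul_nonneg (star_left_conjugate_nonneg hs x) ht
  rw [hτ.mul_comm] at hnonneg
  change 0 ≤ τ (_ * star (LinearMap.mulLeftRight ℂ (s, t) x) * _ * x)
  simpa [hs.star_eq, ht.star_eq, mul_assoc] using hnonneg

variable {A B : Type*} [CStarAlgebra A] [PartialOrder A] [StarOrderedRing A]
  [CStarAlgebra B] [PartialOrder B] [StarOrderedRing B]
  {τA : A →ₗ[ℂ] ℂ} {τB : B →ₗ[ℂ] ℂ} {r : Aˣ} {r' : Bˣ} {α : B →ₗ[ℂ] A} {β : A →ₗ[ℂ] B}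

namespace IsKMSPair

theorem fixed_modular_sq_mul (h : IsKMSPair τA τB r r' α β) {d : A} {d' : B} {x : A}
    (hx : α (β x) = x)
    (hd : α (β (↑r⁻¹ * d * ↑r⁻¹)) = ↑r⁻¹ * d * ↑r⁻¹)
    (hβ : β (↑r⁻¹ * d * ↑r⁻¹) = ↑r'⁻¹ * d' * ↑r'⁻¹) :
    α (β (↑r⁻¹ * (↑r⁻¹ * x * d))) = ↑r⁻¹ * (↑r⁻¹ * x * d) ∧
      β (↑r⁻¹ * (↑r⁻¹ * x * d)) = ↑r'⁻¹ * (↑r'⁻¹ * β x * d') := by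
  obtain ⟨hx₁, hβx₁⟩ := h.modular hx
  obtain ⟨hx₂, hβx₂⟩ := h.modular hx₁
  obtain ⟨hd₁, hβd₁⟩ := h.modular hd
  have hfactor : (↑r⁻¹ : A) * (↑r⁻¹ * x * d) =
      ↑r⁻¹ * (↑r⁻¹ * x * r) * r * (↑r⁻¹ * (↑r⁻¹ * d * ↑r⁻¹) * r) := by
    simp [mul_assoc]
  rw [hfactor]
  refine ⟨h.fixed_mul hx₂ hd₁, ?_⟩
  rw [h.map_mul_fixed hd₁, hβx₂, hβx₁, hβd₁, hβ]
  simp [mul_assoc]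

theorem fixed_cocycle [FiniteDimensional ℂ A] (h : IsKMSPair τA τB r r' α β) {t : A} {t' : B}
    (ht : 0 ≤ t) (ht' : 0 ≤ t')
    (hd : α (β (↑r⁻¹ * (t * t) * ↑r⁻¹)) = ↑r⁻¹ * (t * t) * ↑r⁻¹)
    (hβ : β (↑r⁻¹ * (t * t) * ↑r⁻¹) = ↑r'⁻¹ * (t' * t') * ↑r'⁻¹) :
    α (β (↑r⁻¹ * t)) = ↑r⁻¹ * t ∧ β (↑r⁻¹ * t) = ↑r'⁻¹ * t' := by
  have hs : 0 ≤ (↑r⁻¹ : A) := CFC.inv_nonneg_of_nonneg r h.nonnegA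
  have hs' : 0 ≤ (↑r'⁻¹ : B) := CFC.inv_nonneg_of_nonneg r' h.nonnegB
  have hsq (x : A) (hx : α (β x) = x) := h.fixed_modular_sq_mul hx hd hβ
  have hone : (1 : A) ∈ LinearMap.eqLocus (α ∘ₗ β) LinearMap.id := by
    simp [h.schwarzA.map_one, h.schwarzB.map_one]
  obtain ⟨hfix, hmap⟩ := core_map_apply_of_map_apply_apply (h.traceA.kmsCore 1 zero_le_one)
    (h.traceB.kmsCore 1 zero_le_one) (h.traceA.kmsCore_one_inner_mulLeftRight_nonneg hs ht)
    (h.traceB.kmsCore_one_inner_mulLeftRight_nonneg hs' ht') (β := β)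
    (D := LinearMap.eqLocus (α ∘ₗ β) LinearMap.id)
    (fun x hx => by simpa [mul_assoc] using (hsq x hx).1)
    (fun x hx => by simpa [mul_assoc] using (hsq x hx).2) hone
  exact ⟨by simpa using hfix, by simpa [h.schwarzB.map_one] using hmap⟩

theorem fixed_cocycle_star (h : IsKMSPair τA τB r r' α β) {t : A} {t' : B} (ht : 0 ≤ t)
    (ht' : 0 ≤ t') (hfix : α (β (↑r⁻¹ * t)) = ↑r⁻¹ * t) (hβ : β (↑r⁻¹ * t) = ↑r'⁻¹ * t') :
    α (β (t * ↑r⁻¹)) = t * ↑r⁻¹ ∧ β (t * ↑r⁻¹) = t' * ↑r'⁻¹ := by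
  have hs : star (↑r⁻¹ : A) = ↑r⁻¹ := (CFC.inv_nonneg_of_nonneg r h.nonnegA).star_eq
  have hs' : star (↑r'⁻¹ : B) = ↑r'⁻¹ := (CFC.inv_nonneg_of_nonneg r' h.nonnegB).star_eq
  have hstar : t * ↑r⁻¹ = star (↑r⁻¹ * t) := by rw [star_mul, hs, ht.star_eq]
  rw [hstar]
  refine ⟨h.fixed_star hfix, ?_⟩
  rw [h.schwarzB.isPositiveUnital.map_star, hβ, star_mul, hs', ht'.star_eq]

end IsKMSPair

end Cocycle

/-- `t` is positive with support projection `q`, and `k` is its inverse on the support. The instance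
of interest is `t = σ^{1/2}`, `k = σ^{-1/2}`, `q = supp σ`. -/
structure IsSupportInverse {A : Type*} [Ring A] [PartialOrder A] (t k q : A) : Prop where
  nonneg : 0 ≤ t
  mul_inv : t * k = q
  inv_mul : k * t = q
  mul_supp : t * q = t

namespace IsSupportInverse

theorem supp_mul {A : Type*} [Ring A] [PartialOrder A] {t k q : A} (h : IsSupportInverse t k q) :
    q * t = t := by
  rw [← h.mul_inv, mul_assoc, h.inv_mul, h.mul_supp]

theorem isStarProjection {A : Type*} [Ring A] [StarRing A] [PartialOrder A] [StarOrderedRing A]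
    {t k q : A} (h : IsSupportInverse t k q) : IsStarProjection q := by
  have hstar_mul : star q * q = q := by
    nth_rw 2 [← h.mul_inv]
    rw [← mul_assoc, ← h.nonneg.star_eq, ← star_mul, h.mul_supp, h.nonneg.star_eq, h.mul_inv]
  have hq : IsSelfAdjoint q := hstar_mul ▸ IsSelfAdjoint.star_mul_self q
  exact ⟨by rwa [hq.star_eq] at hstar_mul, hq⟩

theorem inv_mul_sq_mul_inv {A : Type*} [Ring A] [PartialOrder A] {t k q : A}
    (h : IsSupportInverse t k q) : k * (t * t) * k = q := by
  rw [← mul_assoc, h.inv_mul, h.supp_mul, h.mul_inv]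

theorem map_supp_eq_supp {A B : Type*} [Ring A] [StarRing A] [PartialOrder A] [StarOrderedRing A]
    [Ring B] [PartialOrder B] {T β : A → B} {t k q : A} {t' k' q' : B} (h : IsSupportInverse t k q)
    (h' : IsSupportInverse t' k' q') (hT : T (t * t) = t' * t')
    (heq : ∀ b, k' * T (t * (q * b * q) * t) * k' = β (q * b * q)) : β q = q' := by
  have hone := heq 1
  rw [mul_one, h.isStarProjection.isIdempotentElem.eq, h.mul_supp, hT,
    h'.inv_mul_sq_mul_inv] at hone
  exact hone.symm

end IsSupportInverse

section Forward

variable {A B : Type*} [CStarAlgebra A] [PartialOrder A] [StarOrderedRing A]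
  [CStarAlgebra B] [PartialOrder B] [StarOrderedRing B]
  {τA : A →ₗ[ℂ] ℂ} {τB : B →ₗ[ℂ] ℂ} {r : Aˣ} {r' : Bˣ} {α : B →ₗ[ℂ] A} {β : A →ₗ[ℂ] B}

namespace IsKMSPair

theorem fixed_of_recovered [FiniteDimensional ℂ A] (h : IsKMSPair τA τB r r' α β)
    {γ : A →ₗ[ℂ] B} {S : B →ₗ[ℂ] A} (hγ : IsSchwarzMap γ)
    (hS : ∀ a b, τB (γ a * b) = τA (a * S b)) (hSr : S (r' * r') = r * r) {d : A}
    (hd : S (r' * β d * r') = r * d * r) : α (β d) = d := by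
  have hs : 0 ≤ (↑r⁻¹ : A) := CFC.inv_nonneg_of_nonneg r h.nonnegA
  let δ := LinearMap.mulLeftRight ℂ ((↑r⁻¹ : A), (↑r⁻¹ : A)) ∘ₗ S ∘ₗ
    LinearMap.mulLeftRight ℂ ((r' : B), (r' : B))
  have hδ_apply (b : B) : δ b = ↑r⁻¹ * S (r' * b * r') * ↑r⁻¹ := by simp [δ]
  have hδ : IsPositiveUnital δ :=
    { map_one := by simp [hδ_apply, hSr]
      map_nonneg := fun hb => by
        rw [hδ_apply]
        exact hs.isSelfAdjoint.conjugate_nonneg <| h.traceA.map_nonneg_of_adjoint h.traceB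
          (fun a => hγ.isPositiveUnital.map_nonneg) hS
          (h.nonnegB.isSelfAdjoint.conjugate_nonneg hb) }
  refine kms_adjoint_apply_eq_of_left_inverse_at h.traceA h.traceB h.nonnegA h.nonnegB
    h.schwarzA.isPositiveUnital h.schwarzB.isPositiveUnital hγ.isPositiveUnital hδ h.dual ?_ ?_
  · intro a b
    calc τA (r * a * r * δ b) = τA (r * (a * S (r' * b * r') * ↑r⁻¹)) := by
          simp [hδ_apply, mul_assoc]
      _ = τB (γ a * r' * b * r') := by
          rw [h.traceA.mul_comm, Units.inv_mul_cancel_right, ← hS, ← mul_assoc, ← mul_assoc]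
      _ = τB (r' * γ a * r' * b) := by
          rw [h.traceB.mul_comm, ← mul_assoc, ← mul_assoc]
  · rw [hδ_apply, hd]
    simp [mul_assoc]

variable {t : A} {t' : B}

theorem map_cocycle_conj (h : IsKMSPair τA τB r r' α β) (ht : 0 ≤ t) (ht' : 0 ≤ t')
    (hfix : α (β (↑r⁻¹ * t)) = ↑r⁻¹ * t) (hβ : β (↑r⁻¹ * t) = ↑r'⁻¹ * t') (a : A) :
    β (↑r⁻¹ * (t * a * t) * ↑r⁻¹) = ↑r'⁻¹ * (t' * β a * t') * ↑r'⁻¹ := by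
  obtain ⟨hfix_star, hβ_star⟩ := h.fixed_cocycle_star ht ht' hfix hβ
  calc β (↑r⁻¹ * (t * a * t) * ↑r⁻¹) = β (↑r⁻¹ * t * a * (t * ↑r⁻¹)) := by simp only [mul_assoc]
    _ = ↑r'⁻¹ * t' * β a * (t' * ↑r'⁻¹) := by
        rw [h.map_mul_fixed hfix_star, h.map_fixed_mul hfix, hβ, hβ_star]
    _ = ↑r'⁻¹ * (t' * β a * t') * ↑r'⁻¹ := by simp only [mul_assoc]

theorem map_conj (h : IsKMSPair τA τB r r' α β) (ht : 0 ≤ t) (ht' : 0 ≤ t')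
    (hfix : α (β (↑r⁻¹ * t)) = ↑r⁻¹ * t) (hβ : β (↑r⁻¹ * t) = ↑r'⁻¹ * t') (a : A) :
    β (t * a * t) = t' * (↑r'⁻¹ * β (r * a * r) * ↑r'⁻¹) * t' := by
  obtain ⟨hfix_star, hβ_star⟩ := h.fixed_cocycle_star ht ht' hfix hβ
  calc β (t * a * t) = β (t * ↑r⁻¹ * (r * a * r) * (↑r⁻¹ * t)) := by simp [mul_assoc]
    _ = t' * ↑r'⁻¹ * β (r * a * r) * (↑r'⁻¹ * t') := by
        rw [h.map_mul_fixed hfix, h.map_fixed_mul hfix_star, hβ, hβ_star]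
    _ = t' * (↑r'⁻¹ * β (r * a * r) * ↑r'⁻¹) * t' := by simp only [mul_assoc]

theorem supp_conj_map_supp_conj (h : IsKMSPair τA τB r r' α β) {k q : A} {k' q' : B}
    (ht : IsSupportInverse t k q) (ht' : IsSupportInverse t' k' q')
    (hfix : α (β (↑r⁻¹ * t)) = ↑r⁻¹ * t) (hβ : β (↑r⁻¹ * t) = ↑r'⁻¹ * t') (b : A) :
    q' * β (q * b * q) * q' = β (q * b * q) := by
  have hconj : q * b * q = t * (k * b * k) * t := by
    nth_rw 1 [← ht.mul_inv]
    rw [← ht.inv_mul]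
    simp only [mul_assoc]
  rw [hconj, h.map_conj ht.nonneg ht'.nonneg hfix hβ, mul_assoc t', ← mul_assoc q', ht'.supp_mul,
    mul_assoc, mul_assoc _ t', ht'.mul_supp]

theorem inv_conj_map_conj (h : IsKMSPair τA τB r r' α β) {k q : A} {k' q' : B}
    (ht : IsSupportInverse t k q) (ht' : IsSupportInverse t' k' q')
    (hfix : α (β (↑r⁻¹ * t)) = ↑r⁻¹ * t) (hβ : β (↑r⁻¹ * t) = ↑r'⁻¹ * t') (b : A) :
    k' * (r' * β (↑r⁻¹ * (t * (q * b * q) * t) * ↑r⁻¹) * r') * k' = β (q * b * q) := by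
  rw [h.map_cocycle_conj ht.nonneg ht'.nonneg hfix hβ]
  calc k' * (r' * (↑r'⁻¹ * (t' * β (q * b * q) * t') * ↑r'⁻¹) * r') * k'
      = k' * t' * β (q * b * q) * (t' * k') := by simp [mul_assoc]
    _ = β (q * b * q) := by
        rw [ht'.inv_mul, ht'.mul_inv, h.supp_conj_map_supp_conj ht ht' hfix hβ]

end IsKMSPair

end Forward

section Converse

variable {A B : Type*} [CStarAlgebra A] [PartialOrder A] [StarOrderedRing A]
  [CStarAlgebra B] [PartialOrder B] [StarOrderedRing B]

namespace IsSchwarzMap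

variable {Φ : A →ₗ[ℂ] B} {q : A}

theorem map_mul_of_isStarProjection (hΦ : IsSchwarzMap Φ) (hq : IsStarProjection q)
    (hΦq : IsStarProjection (Φ q)) (a : A) : Φ (a * q) = Φ a * Φ q := by
  refine hΦ.map_mul_of_schwarzDefect_eq_zero ?_ a
  rw [schwarzDefect_apply, hq.isSelfAdjoint.star_eq, hq.isIdempotentElem.eq,
    hΦq.isSelfAdjoint.star_eq, hΦq.isIdempotentElem.eq, sub_self]

theorem map_mul_of_isStarProjection_left (hΦ : IsSchwarzMap Φ) (hq : IsStarProjection q)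
    (hΦq : IsStarProjection (Φ q)) (a : A) : Φ (q * a) = Φ q * Φ a := by
  have hstar := hΦ.map_mul_of_isStarProjection hq hΦq (star a)
  rw [← hq.isSelfAdjoint.star_eq, ← star_mul, hΦ.isPositiveUnital.map_star,
    hΦ.isPositiveUnital.map_star, hΦ.isPositiveUnital.map_star, ← star_mul] at hstar
  exact star_injective hstar

end IsSchwarzMap

variable {τA : A →ₗ[ℂ] ℂ} {τB : B →ₗ[ℂ] ℂ} {T : A →ₗ[ℂ] B} {α : B →ₗ[ℂ] A} {t k q : A}
  {t' k' q' : B}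

theorem map_supp_mul (hA : IsFaithfulTrace τA) (hα : IsPositiveUnital α)
    (hT : ∀ b a, τA (α b * a) = τB (b * T a)) (ht : IsSupportInverse t k q)
    (ht' : IsSupportInverse t' k' q') (hTt : T (t * t) = t' * t') : α q' * t = t := by
  have hzero : α (1 - q') * (t * t) = 0 := by
    refine hA.mul_eq_zero_of_apply_eq_zero (hα.map_nonneg ht'.isStarProjection.one_sub.nonneg)
      ht.nonneg.isSelfAdjoint.mul_self_nonneg ?_
    rw [hT, hTt, sub_mul, one_mul, ← mul_assoc, ht'.supp_mul, sub_self, map_zero]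
  have hzero' : α (1 - q') * t = 0 := calc
    α (1 - q') * t = α (1 - q') * (t * t) * k := by
      rw [mul_assoc, mul_assoc t, ht.mul_inv, ht.mul_supp]
    _ = 0 := by rw [hzero, zero_mul]
  rw [map_sub, hα.map_one, sub_mul, one_mul, sub_eq_zero] at hzero'
  exact hzero'.symm

theorem recovered_of_forall_eq {S : B →ₗ[ℂ] A} {β : A →ₗ[ℂ] B} (hA : IsFaithfulTrace τA)
    (hB : IsFaithfulTrace τB) (hα : IsPositiveUnital α) (hβ : IsSchwarzMap β)
    (hT : ∀ b a, τA (α b * a) = τB (b * T a)) (hS : ∀ a b, τB (β a * b) = τA (a * S b))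
    (ht : IsSupportInverse t k q) (ht' : IsSupportInverse t' k' q') (hTt : T (t * t) = t' * t')
    (heq : ∀ b, k' * T (t * (q * b * q) * t) * k' = β (q * b * q)) : S (t' * t') = t * t := by
  have hβq := ht.map_supp_eq_supp ht' hTt heq
  have hβq' : IsStarProjection (β q) := hβq ▸ ht'.isStarProjection
  have hcorner (a : A) : β (q * a * q) = q' * β a * q' := by
    rw [hβ.map_mul_of_isStarProjection ht.isStarProjection hβq',
      hβ.map_mul_of_isStarProjection_left ht.isStarProjection hβq', hβq]
  have htqt (a : A) : t * (q * a * q) * t = t * a * t := by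
    rw [← mul_assoc, ← mul_assoc, ht.mul_supp, mul_assoc _ q, ht.supp_mul]
  refine hA.ext_apply_mul fun a => ?_
  calc τA (a * S (t' * t')) = τB (β a * (q' * t' * (t' * q'))) := by
        rw [← hS, ht'.supp_mul, ht'.mul_supp]
    _ = τB (q' * (β a * q' * (t' * t'))) := by
        rw [hB.mul_comm q']
        simp only [mul_assoc]
    _ = τB (β (q * a * q) * (t' * t')) := by rw [hcorner]; simp only [mul_assoc]
    _ = τB (k' * (T (t * a * t) * (k' * (t' * t')))) := by
        rw [← heq, htqt]
        simp only [mul_assoc]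
    _ = τB (q' * T (t * a * t)) := by
        rw [hB.mul_comm k', mul_assoc, ht'.inv_mul_sq_mul_inv, hB.mul_comm]
    _ = τA (t * (a * t)) := by
        rw [← hT, mul_assoc t, ← mul_assoc, map_supp_mul hA hα hT ht ht' hTt]
    _ = τA (a * (t * t)) := by rw [hA.mul_comm, mul_assoc]

end Converse

section Operator

variable {H : Type*} [NormedAddCommGroup H] [InnerProductSpace ℂ H] [FiniteDimensional ℂ H]

theorem continuousOn_spectrum (a : H →L[ℂ] H) (f : ℝ → ℝ) : ContinuousOn f (spectrum ℝ a) := by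
  have hfinite : (spectrum ℂ a).Finite := by
    rw [← AlgEquiv.spectrum_eq (Module.End.toContinuousLinearMap H).symm a]
    exact Module.End.finite_spectrum _
  refine Set.Finite.continuousOn ?_ f
  rw [← spectrum.preimage_algebraMap ℂ]
  exact hfinite.preimage (FaithfulSMul.algebraMap_injective ℝ ℂ).injOn

variable [CompleteSpace H]

theorem isSupportInverse_sqrt {a : H →L[ℂ] H} (ha : 0 ≤ a) :
    IsSupportInverse (CFC.sqrt a) (invSqrt a) (CFC.sqrt a * invSqrt a) := by
  have hsqrt : CFC.sqrt a = cfc Real.sqrt a := by rw [CFC.sqrt_eq_real_sqrt a, cfcₙ_eq_cfc]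
  have hcomm : invSqrt a * CFC.sqrt a = CFC.sqrt a * invSqrt a := by
    rw [hsqrt]
    exact cfc_commute_cfc _ _ a
  have hcont := continuousOn_spectrum a
  refine ⟨CFC.sqrt_nonneg a, rfl, hcomm, ?_⟩
  rw [← hcomm, ← mul_assoc, hsqrt, invSqrt, ← cfc_mul _ _ a (hcont _) (hcont _),
    ← cfc_mul _ _ a (hcont _) (hcont _)]
  exact congrArg (cfc · a) (funext fun x => mul_inv_mul_cancel _)

theorem IsSupportInverse.supp_mul_self {t k q : H →L[ℂ] H} (h : IsSupportInverse t k q) :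
    supp (t * t) = q := by
  have hker : LinearMap.ker (t * t : H →L[ℂ] H).toLinearMap = LinearMap.ker q.toLinearMap := by
    have hq : k * k * (t * t) = q := by
      rw [mul_assoc, ← mul_assoc k t, h.inv_mul, h.supp_mul, h.inv_mul]
    have htt : t * t * q = t * t := by rw [mul_assoc, h.mul_supp]
    ext x
    refine ⟨fun hx => ?_, fun hx => ?_⟩
    · change q x = 0
      rw [← hq]
      exact (congrArg (k * k) hx).trans (map_zero _)
    · change (t * t) x = 0
      rw [← htt]
      exact (congrArg (t * t) hx).trans (map_zero _)
  obtain ⟨U, _, hqU⟩ := isStarProjection_iff_eq_starProjection.1 h.isStarProjection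
  rw [hqU, Submodule.ker_starProjection] at hker
  rw [hqU, supp, Submodule.starProjection_inj, hker, Submodule.orthogonal_orthogonal]

end Operator

section StarSubalgebra

variable {H K : Type*}
  [NormedAddCommGroup H] [InnerProductSpace ℂ H] [FiniteDimensional ℂ H] [CompleteSpace H]
  [NormedAddCommGroup K] [InnerProductSpace ℂ K] [FiniteDimensional ℂ K] [CompleteSpace K]
  {𝒜 : StarSubalgebra ℂ (H →L[ℂ] H)} {ℬ : StarSubalgebra ℂ (K →L[ℂ] K)}

attribute [local instance] isClosed_coe

theorem sqrtIn_mul_self {σ : 𝒜} (hσ : 0 ≤ σ) : sqrtIn σ * sqrtIn σ = σ :=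
  Subtype.ext (CFC.sqrt_mul_sqrt_self (σ : H →L[ℂ] H) hσ)

theorem isSupportInverse_sqrtIn {σ : 𝒜} (hσ : 0 ≤ σ) :
    IsSupportInverse (sqrtIn σ) (invSqrtIn σ) (sqrtIn σ * invSqrtIn σ) where
  nonneg := (isSupportInverse_sqrt hσ).nonneg
  mul_inv := rfl
  inv_mul := Subtype.ext (isSupportInverse_sqrt hσ).inv_mul
  mul_supp := Subtype.ext (isSupportInverse_sqrt hσ).mul_supp

theorem exists_unit_eq_sqrtIn {σ : 𝒜} (hσ : 0 ≤ σ) (hu : IsUnit σ) :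
    ∃ r : 𝒜ˣ, (r : 𝒜) = sqrtIn σ ∧ (↑r⁻¹ : 𝒜) = invSqrtIn σ := by
  have h := isSupportInverse_sqrtIn hσ
  have hsupp : sqrtIn σ * invSqrtIn σ = 1 := by
    refine hu.mul_left_cancel ?_
    nth_rw 1 [← sqrtIn_mul_self hσ]
    rw [mul_assoc, h.mul_supp, sqrtIn_mul_self hσ, mul_one]
  exact ⟨⟨sqrtIn σ, invSqrtIn σ, hsupp, h.inv_mul.trans hsupp⟩, rfl, rfl⟩

theorem eqOn_corner_supp_iff {X : Type*} {σ : 𝒜} (hσ : 0 ≤ σ) {f g : 𝒜 → X} :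
    Set.EqOn f g (corner 𝒜 (supp (σ : H →L[ℂ] H))) ↔
      ∀ b : 𝒜, f (sqrtIn σ * invSqrtIn σ * b * (sqrtIn σ * invSqrtIn σ)) =
        g (sqrtIn σ * invSqrtIn σ * b * (sqrtIn σ * invSqrtIn σ)) := by
  have hsupp : supp (σ : H →L[ℂ] H) = (sqrtIn σ * invSqrtIn σ : 𝒜) := by
    rw [← CFC.sqrt_mul_sqrt_self (σ : H →L[ℂ] H) hσ]
    exact (isSupportInverse_sqrt hσ).supp_mul_self
  rw [hsupp]
  refine ⟨fun h b => h ⟨b, rfl⟩, ?_⟩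
  rintro h a ⟨b, hb⟩
  obtain rfl : a = sqrtIn σ * invSqrtIn σ * b * (sqrtIn σ * invSqrtIn σ) := Subtype.ext hb
  exact h b

theorem starOrderedRing_coe : StarOrderedRing 𝒜 := by
  refine StarOrderedRing.of_nonneg_iff' (fun {x y} hxy z => ?_) (fun x => ⟨fun hx => ?_, ?_⟩)
  · exact add_le_add_right (α := H →L[ℂ] H) hxy z
  · refine ⟨sqrtIn x, ?_⟩
    have hstar : star (sqrtIn x) = sqrtIn x :=
      Subtype.ext (CFC.sqrt_nonneg (x : H →L[ℂ] H)).star_eq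
    rw [hstar, sqrtIn_mul_self hx]
  · rintro ⟨s, rfl⟩
    exact star_mul_self_nonneg (s : H →L[ℂ] H)

attribute [local instance] starOrderedRing_coe

/-- The trace of `B(H)` restricted to `𝒜`, as a linear functional. -/
noncomputable def traceIn (𝒜 : StarSubalgebra ℂ (H →L[ℂ] H)) : 𝒜 →ₗ[ℂ] ℂ where
  toFun a := opTrace (a : H →L[ℂ] H)
  map_add' a b := by simp [opTrace]
  map_smul' c a := by simp [opTrace]

theorem isFaithfulTrace_traceIn : IsFaithfulTrace (traceIn 𝒜) where
  mul_comm a b := LinearMap.trace_mul_comm ℂ _ _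
  map_star a := opTrace_star (a : H →L[ℂ] H)
  nonneg a := by
    change 0 ≤ opTrace (star (a : H →L[ℂ] H) * (a : H →L[ℂ] H))
    rw [opTrace_star_mul_self (stdOrthonormalBasis ℂ H), Complex.zero_le_real]
    positivity
  faithful a h := (hsCore 𝒜).definite a h

theorem IsUnitalSchwarz.isSchwarzMap {Φ : 𝒜 →ₗ[ℂ] ℬ} (h : IsUnitalSchwarz Φ) : IsSchwarzMap Φ :=
  ⟨h.1, h.2⟩

theorem traceIn_star_hsAdjoint_mul (T : 𝒜 →ₗ[ℂ] ℬ) (b : ℬ) (a : 𝒜) :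
    traceIn 𝒜 (star (hsAdjoint T b) * a) = traceIn ℬ (star b * T a) :=
  hsAdjoint_spec T b a

theorem hsAdjoint_hsAdjoint (T : 𝒜 →ₗ[ℂ] ℬ) : hsAdjoint (hsAdjoint T) = T := by
  refine LinearMap.ext fun a => isFaithfulTrace_traceIn.ext_apply_mul fun b => star_injective ?_
  calc star (traceIn ℬ (b * hsAdjoint (hsAdjoint T) a))
      = traceIn ℬ (star (hsAdjoint (hsAdjoint T) a) * star b) := by
        rw [← isFaithfulTrace_traceIn.map_star, star_mul]
    _ = star (traceIn 𝒜 (star (hsAdjoint T (star b)) * a)) := by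
        rw [traceIn_star_hsAdjoint_mul, ← isFaithfulTrace_traceIn.map_star, star_mul, star_star]
    _ = star (traceIn ℬ (b * T a)) := by rw [traceIn_star_hsAdjoint_mul, star_star]

theorem IsUnitalSchwarz.traceIn_hsAdjoint_mul {T : 𝒜 →ₗ[ℂ] ℬ} (hT : IsUnitalSchwarz (hsAdjoint T))
    (b : ℬ) (a : 𝒜) : traceIn 𝒜 (hsAdjoint T b * a) = traceIn ℬ (b * T a) := by
  have h := traceIn_star_hsAdjoint_mul T (star b) a
  rwa [hT.isSchwarzMap.isPositiveUnital.map_star, star_star, star_star] at h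

theorem IsUnitalSchwarz.map_nonneg_of_hsAdjoint {T : 𝒜 →ₗ[ℂ] ℬ}
    (hT : IsUnitalSchwarz (hsAdjoint T)) {a : 𝒜} (ha : 0 ≤ a) : 0 ≤ T a :=
  isFaithfulTrace_traceIn.map_nonneg_of_adjoint isFaithfulTrace_traceIn
    (fun _ => hT.isSchwarzMap.isPositiveUnital.map_nonneg) hT.traceIn_hsAdjoint_mul ha

section Petz

variable {T : 𝒜 →ₗ[ℂ] ℬ} {ρ : 𝒜} {r : 𝒜ˣ} {r' : ℬˣ}

theorem map_eq_conj_petz (hr : (↑r : 𝒜) = sqrtIn ρ) (hr' : (↑r'⁻¹ : ℬ) = invSqrtIn (T ρ)) (x : 𝒜) :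
    T x = r' * petz T ρ (↑r⁻¹ * x * ↑r⁻¹) * r' := by
  change T x = r' * (invSqrtIn (T ρ) * T (sqrtIn ρ * _ * sqrtIn ρ) * invSqrtIn (T ρ)) * r'
  rw [← hr, ← hr']
  simp [mul_assoc]

theorem isKMSPair_petz (hT : IsUnitalSchwarz (hsAdjoint T)) (hTρ : IsUnitalSchwarz (petz T ρ))
    (hr : (↑r : 𝒜) = sqrtIn ρ) (hr' : (↑r' : ℬ) = sqrtIn (T ρ))
    (hr'_inv : (↑r'⁻¹ : ℬ) = invSqrtIn (T ρ)) :
    IsKMSPair (traceIn 𝒜) (traceIn ℬ) r r' (hsAdjoint T) (petz T ρ) where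
  traceA := isFaithfulTrace_traceIn
  traceB := isFaithfulTrace_traceIn
  nonnegA := hr ▸ CFC.sqrt_nonneg (ρ : H →L[ℂ] H)
  nonnegB := hr' ▸ CFC.sqrt_nonneg (T ρ : K →L[ℂ] K)
  schwarzA := hT.isSchwarzMap
  schwarzB := hTρ.isSchwarzMap
  dual a b := by
    rw [isFaithfulTrace_traceIn.mul_comm, hT.traceIn_hsAdjoint_mul, map_eq_conj_petz hr hr'_inv,
      isFaithfulTrace_traceIn.mul_comm]
    simp [mul_assoc]

theorem petz_eqOn_corner_of_recovered (hT : IsUnitalSchwarz (hsAdjoint T))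
    (hTρ : IsUnitalSchwarz (petz T ρ)) (hρ : 0 ≤ ρ) (hρ_inv : IsUnit ρ) (hTρ_inv : IsUnit (T ρ))
    {S : ℬ →ₗ[ℂ] 𝒜} (hS : IsUnitalSchwarz (hsAdjoint S)) (hSρ : S (T ρ) = ρ) {σ : 𝒜} (hσ : 0 ≤ σ)
    (hSσ : S (T σ) = σ) :
    Set.EqOn (petz T σ) (petz T ρ) (corner 𝒜 (supp (σ : H →L[ℂ] H))) := by
  have hTpos {a : 𝒜} (ha : 0 ≤ a) : 0 ≤ T a := hT.map_nonneg_of_hsAdjoint ha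
  obtain ⟨r, hr, -⟩ := exists_unit_eq_sqrtIn hρ hρ_inv
  obtain ⟨r', hr', hr'_inv⟩ := exists_unit_eq_sqrtIn (hTpos hρ) hTρ_inv
  have hpair := isKMSPair_petz hT hTρ hr hr' hr'_inv
  have hT_eq := map_eq_conj_petz (T := T) hr hr'_inv
  have hfix : hsAdjoint T (petz T ρ (↑r⁻¹ * σ * ↑r⁻¹)) = ↑r⁻¹ * σ * ↑r⁻¹ := by
    refine hpair.fixed_of_recovered hS.isSchwarzMap hS.traceIn_hsAdjoint_mul ?_ ?_
    · rw [hr, hr', sqrtIn_mul_self hρ, sqrtIn_mul_self (hTpos hρ), hSρ]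
    · rw [← hT_eq, hSσ]
      simp [mul_assoc]
  have hmap : petz T ρ (↑r⁻¹ * σ * ↑r⁻¹) = ↑r'⁻¹ * T σ * ↑r'⁻¹ := by
    rw [hT_eq σ]
    simp [mul_assoc]
  have ht := isSupportInverse_sqrtIn hσ
  have ht' := isSupportInverse_sqrtIn (hTpos hσ)
  rw [← sqrtIn_mul_self hσ] at hfix
  rw [← sqrtIn_mul_self (hTpos hσ)] at hmap
  nth_rw 1 [← sqrtIn_mul_self hσ] at hmap
  obtain ⟨hfix_cocycle, hmap_cocycle⟩ := hpair.fixed_cocycle ht.nonneg ht'.nonneg hfix hmap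
  rw [eqOn_corner_supp_iff hσ]
  intro b
  rw [← hpair.inv_conj_map_conj ht ht' hfix_cocycle hmap_cocycle, ← hT_eq]
  rfl

theorem hsAdjoint_petz_map_of_eqOn_corner (hT : IsUnitalSchwarz (hsAdjoint T))
    (hTρ : IsUnitalSchwarz (petz T ρ)) {σ : 𝒜} (hσ : 0 ≤ σ)
    (heq : Set.EqOn (petz T σ) (petz T ρ) (corner 𝒜 (supp (σ : H →L[ℂ] H)))) :
    hsAdjoint (petz T ρ) (T σ) = σ := by
  have hTσ : 0 ≤ T σ := hT.map_nonneg_of_hsAdjoint hσ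
  have hadj (a : 𝒜) (b : ℬ) :
      traceIn ℬ (petz T ρ a * b) = traceIn 𝒜 (a * hsAdjoint (petz T ρ) b) := by
    have hS : IsUnitalSchwarz (hsAdjoint (hsAdjoint (petz T ρ))) := by rwa [hsAdjoint_hsAdjoint]
    rw [← hS.traceIn_hsAdjoint_mul, hsAdjoint_hsAdjoint]
  have hrec := recovered_of_forall_eq isFaithfulTrace_traceIn isFaithfulTrace_traceIn
    hT.isSchwarzMap.isPositiveUnital hTρ.isSchwarzMap hT.traceIn_hsAdjoint_mul hadj
    (isSupportInverse_sqrtIn hσ) (isSupportInverse_sqrtIn hTσ)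
    (by rw [sqrtIn_mul_self hσ, sqrtIn_mul_self hTσ]) ((eqOn_corner_supp_iff hσ).1 heq)
  rwa [sqrtIn_mul_self hσ, sqrtIn_mul_self hTσ] at hrec

end Petz

end StarSubalgebra

end PetzRecovery

theorem mainTheorem9 {H K : Type*}
    [NormedAddCommGroup H] [InnerProductSpace ℂ H] [FiniteDimensional ℂ H] [CompleteSpace H]
    [NormedAddCommGroup K] [InnerProductSpace ℂ K] [FiniteDimensional ℂ K] [CompleteSpace K]
    (𝒜 : StarSubalgebra ℂ (H →L[ℂ] H)) (ℬ : StarSubalgebra ℂ (K →L[ℂ] K))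
    (T : 𝒜 →ₗ[ℂ] ℬ) (𝒮 : Set 𝒜) (h𝒮 : 𝒮 ⊆ PetzRecovery.densities 𝒜)
    (ρ : 𝒜) (hρ : ρ ∈ 𝒮) (hρ_inv : IsUnit ρ) (hTρ_inv : IsUnit (T ρ))
    (hT : PetzRecovery.IsUnitalSchwarz (PetzRecovery.hsAdjoint T))
    (hTρ : PetzRecovery.IsUnitalSchwarz (PetzRecovery.petz T ρ)) :
    PetzRecovery.IsReversible T 𝒮 ↔
      ∀ σ ∈ 𝒮, Set.EqOn (PetzRecovery.petz T σ) (PetzRecovery.petz T ρ)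
        (PetzRecovery.corner 𝒜 (PetzRecovery.supp (σ : H →L[ℂ] H))) := by
  have hpos (σ : 𝒜) (hσ : σ ∈ 𝒮) : 0 ≤ σ := (h𝒮 hσ).1
  constructor
  · rintro ⟨S, hS, hrev⟩ σ hσ
    exact PetzRecovery.petz_eqOn_corner_of_recovered hT hTρ (hpos ρ hρ) hρ_inv hTρ_inv hS
      (hrev ρ hρ) (hpos σ hσ) (hrev σ hσ)
  · intro heq
    exact ⟨PetzRecovery.hsAdjoint (PetzRecovery.petz T ρ),
      by rwa [PetzRecovery.hsAdjoint_hsAdjoint], fun σ hσ =>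
        PetzRecovery.hsAdjoint_petz_map_of_eqOn_corner hT hTρ (hpos σ hσ) (heq σ hσ)⟩
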